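/- All rings are commutative with $1$. An ideal $D$ of $A$ is dense if $aD=0$, $a\in A$, implies $a=0$. A ring $B\supseteq A$ is a rational extension of $A$ if for all $b,b'\in B$ with $b'\ne 0$ there is $a\in A$ with $ba\in A$ and $b'a\neq 0$; $A$ is rationally complete if it has no proper rational extension. The maximal ring of quotients of $A$ is $\mathcal Q(A)=\varinjlim_D \operatorname{Hom}_A(D,A)$, over all dense ideals $D$ of $A$, with composition as multiplication. For a filter base $\mathcal S$ (closed under finite intersection) of dense subsets of a space $Y$, let $C[\mathcal S]=\varinjlim_{S\in\mathcal S}C(S)$ (real-valued continuous functions, restriction maps), with the metric $d(f,g)=\sup \frac{|f-g|}{1+|f-g|}$, and let $C^*[\mathcal S]$ be its subring of bounded functions. Let $X$ be a completely regular Hausdorff space with Stone–Čech compactification $\beta X$, and let $Q(X)=\mathcal Q(C(X))$, which is canonically $C[\mathcal V_0(X)]$ for $\mathcal V_0(X)$ the family of dense open subsets of $X$. The metric completion $\bar Q(X)$ of $Q(X)$ is a ring by virtue of its realization as $C[\mathcal G_0(\beta X)]$, where $\mathcal G_0(\beta X)$ is the family of dense $G_\delta$-subsets of $\beta X$: there is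 an isometric ring embedding $Q(X)\to C[\mathcal G_0(\beta X)]$ with dense image, compatible with the embeddings of $C(\beta X)=C^*(X)$, and $C[\mathcal G_0(\beta X)]$ is complete. Let $\bar Q^*(X)=C^*[\mathcal G_0(\beta X)]$ be the subring of bounded functions in $\bar Q(X)$. **Theorem.** The ring $\bar Q(X)$ is rationally complete. Hence $\bar Q(X)$ is the maximal ring of quotients of $\bar Q^*(X)$, that is, $\mathcal Q(\bar Q^*(X))\cong\bar Q(X)$ as $\bar Q^*(X)$-algebras; and the bounded part of $\mathcal Q(\bar Q^*(X))$ is $\bar Q^*(X)$: an element of $\mathcal Q(\bar Q^*(X))$ lies in $\bar Q^*(X)$ if and only if it is bounded, i.e. it is represented by some $\varphi\in\operatorname{Hom}(D,\bar Q^*(X))$, $D$ a dense ideal of $\bar Q^*(X)$, for which there is a constant $M$ with $|\varphi(d)|\le M|d|$ pointwise for all $d\in D$ (the function $\varphi(d)/d$ is bounded by $M$). The formal statement includes, as part of its conclusion, the two identifications above ($\mathcal Q(C(X))\cong C[\mathcal V_0(X)]$ over $C(X)$, and $C[\mathcal G_0(\beta X)]$ as the metric completion of $C[\mathcal V_0(X)]$).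 -/

import Mathlib

namespace FGL

/-! ### Rational extensions and the maximal ring of quotients of a commutative ring -/

section Quotients

/-- An ideal is (rationally) dense if its only annihilator in the ring is `0`. -/
def IsDenseIdeal {A : Type*} [CommRing A] (D : Ideal A) : Prop :=
  ∀ a : A, (∀ d ∈ D, a * d = 0) → a = 0

/-- `B`, a ring containing `A`, is a ring of quotients (rational extension) of `A`: for all
`b, b' ∈ B` with `b' ≠ 0` there is `a ∈ A` such that `b a ∈ A` and `b' a ≠ 0`. -/
def IsRationalExtension (A B : Type*) [CommRing A] [CommRing B] [Algebra A B] : Prop :=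
  Function.Injective (algebraMap A B) ∧
    ∀ b b' : B, b' ≠ 0 →
      ∃ a : A, b * algebraMap A B a ∈ Set.range (algebraMap A B) ∧ b' * algebraMap A B a ≠ 0

/-- `A` has no proper rational extension (tested on extensions in an arbitrary universe `v`). -/
def IsRationallyComplete.{u, v} (A : Type u) [CommRing A] : Prop :=
  ∀ (B : Type v) [CommRing B] [Algebra A B],
    IsRationalExtension A B → Function.Surjective (algebraMap A B)

variable (A : Type*) [CommRing A]

/-- The dense ideals of `A`, ordered by reverse inclusion. -/
structure DenseIdeals where
  ideal : Ideal A
  dense : IsDenseIdeal ideal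

instance : Preorder (DenseIdeals A) where
  le D E := E.ideal ≤ D.ideal
  le_refl _ := le_rfl
  le_trans _ _ _ h₁ h₂ := le_trans h₂ h₁

variable {A}

theorem IsDenseIdeal.mul {D E : Ideal A} (hD : IsDenseIdeal D) (hE : IsDenseIdeal E) :
    IsDenseIdeal (D * E) := fun a h =>
  hD a fun d hd => hE (a * d) fun e he => by
    rw [mul_assoc]; exact h _ (Ideal.mul_mem_mul hd he)

theorem isDenseIdeal_top : IsDenseIdeal (⊤ : Ideal A) := fun a h => by
  simpa using h 1 Submodule.mem_top

instance : IsDirectedOrder (DenseIdeals A) where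
  directed D E := 
    ⟨⟨D.ideal * E.ideal, D.dense.mul E.dense⟩,
      Ideal.mul_le_left (I := D.ideal) (J := E.ideal), Ideal.mul_le_right (I := D.ideal) (J := E.ideal)⟩

instance : Nonempty (DenseIdeals A) := ⟨⟨⊤, isDenseIdeal_top⟩⟩

/-- `Hom D`, the `A`-linear maps from the ideal `D` to `A`. -/
abbrev HomIdeal (D : DenseIdeals A) : Type _ := D.ideal →ₗ[A] A

/-- Restriction `Hom D → Hom E` for `E ⊆ D`. -/
def HomIdeal.res (D E : DenseIdeals A) (h : D ≤ E) : HomIdeal D →ₗ[A] HomIdeal E :=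
  LinearMap.lcomp A A (Submodule.inclusion h)

@[simp] theorem HomIdeal.res_apply (D E : DenseIdeals A) (h : D ≤ E) (φ : HomIdeal D) (x : E.ideal) :
    HomIdeal.res D E h φ x = φ ⟨x.1, h x.2⟩ := rfl

instance : DirectedSystem (HomIdeal (A := A)) (HomIdeal.res · · ·) where
  map_self _ _ := rfl
  map_map _ _ _ _ _ _ := rfl

variable (A) in
/-- The maximal ring of quotients of `A`, the direct limit of `Hom D` over all dense ideals `D`. -/
def MaxQuot : Type _ := DirectLimit (HomIdeal (A := A)) HomIdeal.res

namespace MaxQuot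

noncomputable instance : AddCommGroup (MaxQuot A) :=
  inferInstanceAs (AddCommGroup (DirectLimit (HomIdeal (A := A)) HomIdeal.res))

/-- The class of `φ ∈ Hom D`. -/
def mk (D : DenseIdeals A) (φ : HomIdeal D) : MaxQuot A :=
  (⟦⟨D, φ⟩⟧ : DirectLimit (HomIdeal (A := A)) HomIdeal.res)

theorem mk_res {D E : DenseIdeals A} (h : D ≤ E) (φ : HomIdeal D) :
    mk E (HomIdeal.res D E h φ) = mk D φ :=
  DirectLimit.mk_apply (f := HomIdeal.res) D E φ h

theorem mk_eq_of_agree {D E F : DenseIdeals A} (φ : HomIdeal D) (ψ : HomIdeal E)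
    (hD : D ≤ F) (hE : E ≤ F) (h : ∀ x : F.ideal, φ ⟨x.1, hD x.2⟩ = ψ ⟨x.1, hE x.2⟩) :
    mk D φ = mk E ψ := by
  rw [← mk_res hD φ, ← mk_res hE ψ]
  congr 1
  ext x
  exact h x

theorem mk_add (D : DenseIdeals A) (φ ψ : HomIdeal D) : mk D (φ + ψ) = mk D φ + mk D ψ :=
  (DirectLimit.add_def (f := HomIdeal.res) D φ ψ).symm

theorem mk_zero (D : DenseIdeals A) : mk D 0 = 0 :=
  (DirectLimit.zero_def (f := HomIdeal.res) D).symm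

/-- `D · E` as a dense ideal. -/
def prodIdeal (D E : DenseIdeals A) : DenseIdeals A := ⟨D.ideal * E.ideal, D.dense.mul E.dense⟩

theorem map_mem_of_mem_mul {D E : Ideal A} (ψ : E →ₗ[A] A) {x : A} (hx : x ∈ D * E) :
    ψ ⟨x, Ideal.mul_le_right hx⟩ ∈ D := by
  suffices D * E ≤ (Submodule.comap ψ D).map E.subtype by
    obtain ⟨y, hy, rfl⟩ := this hx
    exact hy
  refine Ideal.mul_le.2 fun d hd e he => ⟨d • ⟨e, he⟩, ?_, rfl⟩
  change ψ (d • ⟨e, he⟩) ∈ D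
  rw [map_smul, smul_eq_mul]
  exact Ideal.mul_mem_right _ _ hd

/-- The composite `φ ∘ ψ`, defined on `D · E`. -/
def comp {D E : DenseIdeals A} (φ : HomIdeal D) (ψ : HomIdeal E) : HomIdeal (prodIdeal D E) where
  toFun x := φ ⟨ψ ⟨x.1, Ideal.mul_le_right x.2⟩, map_mem_of_mem_mul ψ x.2⟩
  map_add' x y := by
    rw [← map_add]; congr 1; ext
    exact map_add ψ ⟨x.1, Ideal.mul_le_right x.2⟩ ⟨y.1, Ideal.mul_le_right y.2⟩
  map_smul' a x := by
    rw [RingHom.id_apply, ← map_smul]; congr 1; ext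
    exact map_smul ψ a ⟨x.1, Ideal.mul_le_right x.2⟩

/-- The product is induced by composition. -/
noncomputable instance : Mul (MaxQuot A) where
  mul := DirectLimit.lift₂ HomIdeal.res HomIdeal.res
    (fun D (φ ψ : HomIdeal D) => mk (prodIdeal D D) (comp φ ψ))
    fun D E h φ ψ => mk_eq_of_agree (F := prodIdeal E E) _ _
      (Ideal.mul_mono h h) le_rfl fun _ => rfl

theorem mk_mul_mk (D E : DenseIdeals A) (φ : HomIdeal D) (ψ : HomIdeal E) :
    mk D φ * mk E ψ = mk (prodIdeal D E) (comp φ ψ) := by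
  have hD : D ≤ prodIdeal D E := Ideal.mul_le_left (I := D.ideal) (J := E.ideal)
  have hE : E ≤ prodIdeal D E := Ideal.mul_le_right (I := D.ideal) (J := E.ideal)
  refine (DirectLimit.lift₂_def₂ HomIdeal.res HomIdeal.res _ _ ⟨D, φ⟩ ⟨E, ψ⟩
    (prodIdeal D E) hD hE).trans ?_
  exact mk_eq_of_agree (F := prodIdeal (prodIdeal D E) (prodIdeal D E)) _ _ le_rfl
    (Ideal.mul_mono hD hE) fun _ => rfl

variable (A) in
/-- Multiplication by `a`, as an element of `Hom A`. -/
def mulHom (a : A) : HomIdeal (⟨⊤, isDenseIdeal_top⟩ : DenseIdeals A) :=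
  LinearMap.mulLeft A a ∘ₗ Submodule.subtype _

noncomputable instance : One (MaxQuot A) := ⟨mk _ (mulHom A 1)⟩

theorem ind₁ {p : MaxQuot A → Prop} (h : ∀ D φ, p (mk D φ)) (x) : p x :=
  DirectLimit.induction HomIdeal.res h x

theorem mul_comm' (x y : MaxQuot A) : x * y = y * x := by
  induction x using ind₁ with | _ D φ
  induction y using ind₁ with | _ E ψ
  rw [mk_mul_mk, mk_mul_mk]
  refine mk_eq_of_agree (F := prodIdeal D E) _ _ le_rfl (mul_comm D.ideal E.ideal).le ?_
  rintro ⟨x, hx⟩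
  change φ ⟨ψ ⟨x, Ideal.mul_le_right hx⟩, map_mem_of_mem_mul ψ hx⟩ =
    ψ ⟨φ ⟨x, Ideal.mul_le_left hx⟩, map_mem_of_mem_mul φ (mul_comm D.ideal E.ideal ▸ hx)⟩
  refine Submodule.mul_induction_on'
    (C := fun x hx => φ ⟨ψ ⟨x, Ideal.mul_le_right hx⟩, map_mem_of_mem_mul ψ hx⟩ =
      ψ ⟨φ ⟨x, Ideal.mul_le_left hx⟩, map_mem_of_mem_mul φ (mul_comm D.ideal E.ideal ▸ hx)⟩) ?_ ?_ hx
  · intro d hd e he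
    have hψ : ψ ⟨d * e, Ideal.mul_le_right (Ideal.mul_mem_mul hd he)⟩ = d * ψ ⟨e, he⟩ :=
      map_smul ψ d ⟨e, he⟩
    have hφ : φ ⟨d * e, Ideal.mul_le_left (Ideal.mul_mem_mul hd he)⟩ = e * φ ⟨d, hd⟩ :=
      (congrArg φ (Subtype.ext (mul_comm d e))).trans (map_smul φ e ⟨d, hd⟩)
    have h1 := (congrArg φ (Subtype.ext (hψ.trans (mul_comm _ _)) :
      ⟨_, map_mem_of_mem_mul ψ (Ideal.mul_mem_mul hd he)⟩ = ψ ⟨e, he⟩ • (⟨d, hd⟩ : D.ideal))).trans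
        (map_smul φ (ψ ⟨e, he⟩) ⟨d, hd⟩)
    have h2 := (congrArg ψ (Subtype.ext (hφ.trans (mul_comm _ _)) :
      ⟨_, map_mem_of_mem_mul φ (mul_comm D.ideal E.ideal ▸ Ideal.mul_mem_mul hd he)⟩ =
        φ ⟨d, hd⟩ • (⟨e, he⟩ : E.ideal))).trans (map_smul ψ (φ ⟨d, hd⟩) ⟨e, he⟩)
    exact h1.trans ((mul_comm _ _).trans h2.symm)
  · intro x hx y hy h1 h2
    have e1 := map_add ψ ⟨x, Ideal.mul_le_right hx⟩ ⟨y, Ideal.mul_le_right hy⟩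
    have e2 := map_add φ ⟨x, Ideal.mul_le_left hx⟩ ⟨y, Ideal.mul_le_left hy⟩
    have e3 := map_add φ ⟨ψ ⟨x, Ideal.mul_le_right hx⟩, map_mem_of_mem_mul ψ hx⟩
      ⟨ψ ⟨y, Ideal.mul_le_right hy⟩, map_mem_of_mem_mul ψ hy⟩
    have e4 := map_add ψ
      ⟨φ ⟨x, Ideal.mul_le_left hx⟩, map_mem_of_mem_mul φ (mul_comm D.ideal E.ideal ▸ hx)⟩
      ⟨φ ⟨y, Ideal.mul_le_left hy⟩, map_mem_of_mem_mul φ (mul_comm D.ideal E.ideal ▸ hy)⟩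
    rw [← h1, ← h2, ← e3] at e4
    refine Eq.trans ?_ (e4.symm.trans ?_)
    · congr 1; ext; exact e1
    · congr 1; ext; exact e2.symm

noncomputable instance : CommRing (MaxQuot A) where
  mul_assoc x y z := by
    induction x using ind₁ with | _ D φ
    induction y using ind₁ with | _ E ψ
    induction z using ind₁ with | _ F χ
    simp only [mk_mul_mk]
    exact mk_eq_of_agree (F := prodIdeal (prodIdeal D E) F) _ _ le_rfl
      (mul_assoc D.ideal E.ideal F.ideal).le fun _ => rfl
  mul_comm := mul_comm'
  one_mul x := by
    induction x using ind₁ with | _ D φ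
    refine (mk_mul_mk ..).trans (mk_eq_of_agree (F := prodIdeal _ D) _ _ le_rfl
      Ideal.mul_le_right fun x => ?_)
    exact one_mul (φ ⟨x.1, Ideal.mul_le_right x.2⟩)
  mul_one x := by
    rw [mul_comm']
    induction x using ind₁ with | _ D φ
    refine (mk_mul_mk ..).trans (mk_eq_of_agree (F := prodIdeal _ D) _ _ le_rfl
      Ideal.mul_le_right fun x => ?_)
    exact one_mul (φ ⟨x.1, Ideal.mul_le_right x.2⟩)
  zero_mul x := by
    induction x using ind₁ with | _ D φ
    rw [← mk_zero D, mk_mul_mk]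
    exact (mk_eq_of_agree (F := prodIdeal D D) _ _ le_rfl Ideal.mul_le_right fun _ => rfl)
  mul_zero x := by
    rw [mul_comm']
    induction x using ind₁ with | _ D φ
    rw [← mk_zero D, mk_mul_mk]
    exact (mk_eq_of_agree (F := prodIdeal D D) _ _ le_rfl Ideal.mul_le_right fun _ => rfl)
  left_distrib x y z := by
    rw [mul_comm' x, mul_comm' x, mul_comm' x]
    induction x using ind₁ with | _ D φ
    revert y z
    refine DirectLimit.induction₂ HomIdeal.res fun E ψ χ => ?_
    change (mk E ψ + mk E χ) * mk D φ = mk E ψ * mk D φ + mk E χ * mk D φ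
    rw [← mk_add, mk_mul_mk, mk_mul_mk, mk_mul_mk, ← mk_add]
    rfl
  right_distrib x y z := by
    induction z using ind₁ with | _ D φ
    revert x y
    refine DirectLimit.induction₂ HomIdeal.res fun E ψ χ => ?_
    change (mk E ψ + mk E χ) * mk D φ = mk E ψ * mk D φ + mk E χ * mk D φ
    rw [← mk_add, mk_mul_mk, mk_mul_mk, mk_mul_mk, ← mk_add]
    rfl
  neg_add_cancel := neg_add_cancel
  sub_eq_add_neg := sub_eq_add_neg
  zsmul := zsmulRec
  nsmul := nsmulRec

variable (A) in
/-- The canonical embedding of `A`, sending `a` to multiplication by `a`. -/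
noncomputable def ofRing : A →+* MaxQuot A where
  toFun a := mk _ (mulHom A a)
  map_one' := rfl
  map_mul' a b := by
    rw [mk_mul_mk]
    refine mk_eq_of_agree (F := prodIdeal _ _) _ _ Ideal.mul_le_right le_rfl fun x => ?_
    exact mul_assoc a b x.1
  map_zero' := by
    rw [← mk_zero]; congr 1; ext x; exact zero_mul _
  map_add' a b := by
    rw [← mk_add]; congr 1; ext x; exact add_mul _ _ _

noncomputable instance : Algebra A (MaxQuot A) := (ofRing A).toAlgebra

end MaxQuot

end Quotients

/-! ### The rings `C[𝒮]` of continuous functions on the members of a filter base of dense sets -/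

section Functions

/-- A filter base, closed under finite intersection, of dense subsets of `X`. -/
structure DenseBase (X : Type*) [TopologicalSpace X] where
  sets : Set (Set X)
  nonempty : sets.Nonempty
  dense : ∀ S ∈ sets, Dense S
  inter_mem : ∀ S ∈ sets, ∀ T ∈ sets, S ∩ T ∈ sets

/-- The family of all dense open sets. -/
def denseOpens (X : Type*) [TopologicalSpace X] : DenseBase X where
  sets := {V | IsOpen V ∧ Dense V}
  nonempty := ⟨Set.univ, isOpen_univ, dense_univ⟩
  dense _ h := h.2
  inter_mem _ hS _ hT := ⟨hS.1.inter hT.1, hS.2.inter_of_isOpen_left hT.2 hS.1⟩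

/-- The family of all dense `G_δ`-sets of a Baire space. -/
def denseGδ (X : Type*) [TopologicalSpace X] [BaireSpace X] : DenseBase X where
  sets := {S | IsGδ S ∧ Dense S}
  nonempty := ⟨Set.univ, IsGδ.univ, dense_univ⟩
  dense _ h := h.2
  inter_mem _ hS _ hT := ⟨hS.1.inter hT.1, hS.2.inter_of_Gδ hS.1 hT.1 hT.2⟩

variable {X : Type*} [TopologicalSpace X] (𝒮 : DenseBase X)

/-- The members of `𝒮`, ordered by reverse inclusion. -/
structure DenseBase.Index where
  set : Set X
  mem : set ∈ 𝒮.sets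

instance : Preorder 𝒮.Index where
  le S T := T.set ⊆ S.set
  le_refl _ := subset_rfl
  le_trans _ _ _ h₁ h₂ := h₂.trans h₁

instance : IsDirectedOrder 𝒮.Index where
  directed S T := ⟨⟨S.set ∩ T.set, 𝒮.inter_mem _ S.mem _ T.mem⟩,
    (Set.inter_subset_left : S.set ∩ T.set ⊆ S.set),
    (Set.inter_subset_right : S.set ∩ T.set ⊆ T.set)⟩

instance : Nonempty 𝒮.Index := let ⟨S, hS⟩ := 𝒮.nonempty; ⟨⟨S, hS⟩⟩

variable {𝒮}

/-- `C(S)` for `S ∈ 𝒮`. -/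
abbrev CFun (S : 𝒮.Index) : Type _ := C(S.set, ℝ)

/-- Restriction `C(S) → C(T)` for `T ⊆ S`. -/
def CFun.res (S T : 𝒮.Index) (h : S ≤ T) : CFun S →ₐ[ℝ] CFun T :=
  ContinuousMap.compRightAlgHom ℝ ℝ ⟨Set.inclusion h, continuous_inclusion h⟩

@[simp] theorem CFun.res_apply (S T : 𝒮.Index) (h : S ≤ T) (f : CFun S) (x : T.set) :
    CFun.res S T h f x = f ⟨x.1, h x.2⟩ := rfl

instance : DirectedSystem (CFun (𝒮 := 𝒮)) (CFun.res · · ·) where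
  map_self _ _ := rfl
  map_map _ _ _ _ _ _ := rfl

variable (𝒮) in
/-- The ring `C[𝒮]`, the direct limit of the rings `C(S)`, `S ∈ 𝒮`, under restriction. -/
def CLim : Type _ := DirectLimit (CFun (𝒮 := 𝒮)) CFun.res

namespace CLim

noncomputable instance : CommRing (CLim 𝒮) :=
  inferInstanceAs (CommRing (DirectLimit (CFun (𝒮 := 𝒮)) CFun.res))

/-- The class of `f ∈ C(S)`. -/
def mk (S : 𝒮.Index) (f : C(S.set, ℝ)) : CLim 𝒮 :=
  (⟦⟨S, f⟩⟧ : DirectLimit (CFun (𝒮 := 𝒮)) CFun.res)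

theorem mk_res {S T : 𝒮.Index} (h : S ≤ T) (f : CFun S) : mk T (CFun.res S T h f) = mk S f :=
  DirectLimit.mk_apply (f := CFun.res) S T f h

theorem mk_add (S : 𝒮.Index) (f g : C(S.set, ℝ)) : mk S (f + g) = mk S f + mk S g :=
  (DirectLimit.add_def (G := CFun) (f := CFun.res) S f g).symm

theorem mk_mul (S : 𝒮.Index) (f g : C(S.set, ℝ)) : mk S (f * g) = mk S f * mk S g :=
  (DirectLimit.mul_def (G := CFun) (f := CFun.res) S f g).symm

theorem mk_one (S : 𝒮.Index) : mk S 1 = 1 := (DirectLimit.one_def (f := CFun.res) S).symm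

theorem mk_zero (S : 𝒮.Index) : mk S 0 = 0 := (DirectLimit.zero_def (f := CFun.res) S).symm

theorem mk_neg (S : 𝒮.Index) (f : C(S.set, ℝ)) : mk S (-f) = -mk S f :=
  (DirectLimit.neg_def (G := CFun) (f := CFun.res) S f).symm

theorem mk_sub (S : 𝒮.Index) (f g : C(S.set, ℝ)) : mk S (f - g) = mk S f - mk S g := by
  rw [sub_eq_add_neg, mk_add, mk_neg, ← sub_eq_add_neg]

theorem ind₁ {p : CLim 𝒮 → Prop} (h : ∀ S f, p (mk S f)) (x) : p x :=
  DirectLimit.induction CFun.res h x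

theorem ind₂ {p : CLim 𝒮 → CLim 𝒮 → Prop} (h : ∀ S f g, p (mk S f) (mk S g)) (x y) : p x y :=
  DirectLimit.induction₂ CFun.res h x y

theorem ind₃ {p : CLim 𝒮 → CLim 𝒮 → CLim 𝒮 → Prop}
    (h : ∀ S f g k, p (mk S f) (mk S g) (mk S k)) (x y z) : p x y z :=
  DirectLimit.induction₃ CFun.res h x y z

variable (𝒮) in
/-- The restriction homomorphism `C(X) → C[𝒮]`. -/
noncomputable def ofC : C(X, ℝ) →+* CLim 𝒮 :=
  let S : 𝒮.Index := Classical.arbitrary _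
  { toFun := fun f => mk S (f.restrict S.set)
    map_one' := mk_one S
    map_mul' := fun f g => mk_mul S (f.restrict S.set) (g.restrict S.set)
    map_zero' := mk_zero S
    map_add' := fun f g => mk_add S (f.restrict S.set) (g.restrict S.set) }

theorem ofC_eq (S : 𝒮.Index) (f : C(X, ℝ)) : ofC 𝒮 f = mk S (f.restrict S.set) := by
  obtain ⟨T, h₁, h₂⟩ := exists_ge_ge (Classical.arbitrary 𝒮.Index) S
  change mk _ _ = _
  rw [← mk_res h₁, ← mk_res h₂]
  rfl

noncomputable instance : Algebra C(X, ℝ) (CLim 𝒮) := (ofC 𝒮).toAlgebra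

/-- `|a| ≤ M |b|` pointwise, for functions `a, b ∈ C[𝒮]`. -/
def AbsLE (M : ℝ) (a b : CLim 𝒮) : Prop :=
  ∃ (S : 𝒮.Index) (f g : C(S.set, ℝ)), a = mk S f ∧ b = mk S g ∧ ∀ s, |f s| ≤ M * |g s|

variable (𝒮) in
/-- The subring `C*[𝒮]` of bounded functions in `C[𝒮]`. -/
def bounded : Subring (CLim 𝒮) where
  carrier := {a | ∃ M : ℝ, ∃ (S : 𝒮.Index) (f : C(S.set, ℝ)), a = mk S f ∧ ∀ s, |f s| ≤ M}
  mul_mem' := by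
    rintro a b ⟨M, S, f, rfl, hf⟩ ⟨N, T, g, rfl, hg⟩
    obtain ⟨U, hS, hT⟩ := exists_ge_ge S T
    refine ⟨|M| * |N|, U, CFun.res S U hS f * CFun.res T U hT g, ?_, fun s => ?_⟩
    · rw [mk_mul, mk_res, mk_res]
    · rw [ContinuousMap.mul_apply, abs_mul]
      exact mul_le_mul ((hf _).trans (le_abs_self M)) ((hg _).trans (le_abs_self N))
        (abs_nonneg _) (abs_nonneg _)
  one_mem' := ⟨1, Classical.arbitrary _, 1, (mk_one _).symm, fun s => by simp⟩
  add_mem' := by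
    rintro a b ⟨M, S, f, rfl, hf⟩ ⟨N, T, g, rfl, hg⟩
    obtain ⟨U, hS, hT⟩ := exists_ge_ge S T
    refine ⟨M + N, U, CFun.res S U hS f + CFun.res T U hT g, ?_, fun s => ?_⟩
    · rw [mk_add, mk_res, mk_res]
    · exact (abs_add_le _ _).trans (add_le_add (hf _) (hg _))
  zero_mem' := ⟨0, Classical.arbitrary _, 0, (mk_zero _).symm, fun s => by simp⟩
  neg_mem' := by
    rintro a ⟨M, S, f, rfl, hf⟩
    exact ⟨M, S, -f, (mk_neg S f).symm, fun s => by simpa using hf s⟩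

/-! The metric of `C[𝒮]`: the distance of `f` and `g` is the supremum of
`|f - g| / (1 + |f - g|)`. -/

theorem div_one_add_lt (t : ℝ) : |t| / (1 + |t|) ≤ 1 :=
  (div_le_one (by positivity)).2 (by linarith)

theorem bddAbove_size {Y : Type*} (f : Y → ℝ) :
    BddAbove (Set.range fun s => |f s| / (1 + |f s|)) :=
  ⟨1, by rintro _ ⟨s, rfl⟩; exact div_one_add_lt _⟩

/-- The sup norm of `|f| / (1 + |f|)`. -/
noncomputable def sizeFun {Y : Type*} [TopologicalSpace Y] (f : C(Y, ℝ)) : ℝ :=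
  ⨆ s, |f s| / (1 + |f s|)

theorem sizeFun_res {S T : 𝒮.Index} (h : S ≤ T) (f : CFun S) :
    sizeFun f = sizeFun (CFun.res S T h f) := by
  have hnn : 0 ≤ sizeFun (CFun.res S T h f) := Real.iSup_nonneg fun s => by positivity
  apply le_antisymm
  · refine Real.iSup_le (fun s => ?_) hnn
    have hd : Dense (Set.range (Set.inclusion h)) := by
      rw [Subtype.dense_iff]
      intro x _
      have : ((↑) : S.set → X) '' Set.range (Set.inclusion h) = T.set := by
        ext y; constructor
        · rintro ⟨_, ⟨z, rfl⟩, rfl⟩; exact z.2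
        · intro hy; exact ⟨_, ⟨⟨y, hy⟩, rfl⟩, rfl⟩
      rw [this]; exact 𝒮.dense _ T.mem x
    have hc : IsClosed {s : S.set | |f s| / (1 + |f s|) ≤ sizeFun (CFun.res S T h f)} := by
      refine isClosed_le (Continuous.div (by fun_prop) (by fun_prop) fun s => ?_) continuous_const
      positivity
    have hsub : Set.range (Set.inclusion h) ⊆
        {s : S.set | |f s| / (1 + |f s|) ≤ sizeFun (CFun.res S T h f)} := by
      rintro _ ⟨z, rfl⟩
      exact le_ciSup (bddAbove_size (CFun.res S T h f)) z
    exact hc.closure_subset_iff.2 hsub (hd s)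
  · refine Real.iSup_le (fun s => ?_) (Real.iSup_nonneg fun s => by positivity)
    exact le_ciSup (bddAbove_size f) (⟨s.1, h s.2⟩ : S.set)

/-- The sup norm of `|a| / (1 + |a|)` for `a ∈ C[𝒮]`, computed on any representative. -/
noncomputable def size : CLim 𝒮 → ℝ :=
  DirectLimit.lift CFun.res (fun _ f => sizeFun f) fun _ _ h f => sizeFun_res h f

theorem size_mk (S : 𝒮.Index) (f : C(S.set, ℝ)) : size (mk S f) = sizeFun f := rfl

theorem le_sizeFun {Y : Type*} [TopologicalSpace Y] (f : C(Y, ℝ)) (s : Y) :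
    |f s| / (1 + |f s|) ≤ sizeFun f := le_ciSup (bddAbove_size f) s

theorem div_one_add_add_le {a b c : ℝ} (h : |a| ≤ |b| + |c|) :
    |a| / (1 + |a|) ≤ |b| / (1 + |b|) + |c| / (1 + |c|) := by
  have ha := abs_nonneg a
  have hb := abs_nonneg b
  have hc := abs_nonneg c
  rw [div_add_div _ _ (by positivity) (by positivity), div_le_div_iff₀ (by positivity)
    (by positivity)]
  nlinarith [mul_nonneg hb hc, mul_nonneg ha hb, mul_nonneg ha hc, mul_nonneg (mul_nonneg ha hb) hc]

noncomputable instance : MetricSpace (CLim 𝒮) where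
  dist a b := size (a - b)
  dist_self a := by
    induction a using ind₁ with | _ S f
    rw [sub_self, ← mk_zero S, size_mk]
    simp [sizeFun]
  dist_comm a b := by
    revert a b
    refine ind₂ fun S f g => ?_
    rw [← mk_sub, ← mk_sub, size_mk, size_mk]
    simp [sizeFun, abs_sub_comm]
  dist_triangle a b c := by
    revert a b c
    refine ind₃ fun S f g k => ?_
    rw [← mk_sub, ← mk_sub, ← mk_sub, size_mk, size_mk, size_mk]
    refine Real.iSup_le (fun s => ?_) (add_nonneg (Real.iSup_nonneg fun s => by positivity)
      (Real.iSup_nonneg fun s => by positivity))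
    exact (div_one_add_add_le (abs_sub_le (f s) (g s) (k s))).trans
      (add_le_add (le_sizeFun (f - g) s) (le_sizeFun (g - k) s))
  eq_of_dist_eq_zero := by
    refine fun {a b} => @ind₂ _ _ _ (fun a b => size (a - b) = 0 → a = b) (fun S f g h => ?_) a b
    rw [← mk_sub, size_mk] at h
    congr 1
    ext s
    have h1 := le_sizeFun (f - g) s
    rw [h] at h1
    have h2 : 0 ≤ |(f - g) s| := abs_nonneg _
    have h3 : |(f - g) s| = 0 := by
      by_contra hne
      have : 0 < |(f - g) s| / (1 + |(f - g) s|) := by positivity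
      linarith
    exact sub_eq_zero.1 (abs_eq_zero.1 h3)

end CLim

/-- An element `q` of the maximal ring of quotients of `C*[𝒮]` is a bounded function: `q` is the
class of some `φ ∈ Hom D`, i.e. it is the function whose value is `φ(d) / d` where `d ∈ D` does not
vanish, and `|φ(d) / d| ≤ M` for a constant `M`. -/
def IsBoundedQuotient (q : MaxQuot (CLim.bounded 𝒮)) : Prop :=
  ∃ (D : DenseIdeals (CLim.bounded 𝒮)) (φ : HomIdeal D) (M : ℝ), q = MaxQuot.mk D φ ∧
    ∀ d : D.1, CLim.AbsLE M (φ d : CLim 𝒮) ((d : CLim.bounded 𝒮) : CLim 𝒮)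

end Functions

/-- `Q(X)`, realised as the ring of continuous functions on the dense open subsets of `X`. -/
abbrev Q (X : Type*) [TopologicalSpace X] : Type _ := CLim (denseOpens X)

/-- The completion of `Q(X)`, realised as the ring of continuous functions on the dense
`G_δ`-subsets of the Stone-Čech compactification of `X`. -/
abbrev QBar (X : Type*) [TopologicalSpace X] : Type _ := CLim (denseGδ (StoneCech X))

/-- The subring of bounded functions in the completion of `Q(X)`. -/
noncomputable abbrev QBarStar (X : Type*) [TopologicalSpace X] : Subring (QBar X) :=
  CLim.bounded (denseGδ (StoneCech X))

end FGL

universe u v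

/-! An element `φ` of `Hom D` in a ring of functions should be read as the function `φ d / d`,
defined where some `d ∈ D` is nonzero. The fractions agree on overlaps, since `d * φ e` and `e * φ
d` are both `φ (d * e)`. The sets where the `d` do not vanish have dense union, for otherwise a bump
function would annihilate `D`. By Zorn there is a disjoint family of open sets, still with dense
union, each inside one such set, and one fraction is kept on each member. The glued function lives
on a member of the filter base: clear for dense open sets, and for dense `G_δ`-sets because
disjointness lets the union commute with countable intersections. This is `exists_mul_eq`: every `φ`
is multiplication by some `c ∈ C[𝒮]`.

Rational completeness follows at once. Since `C[𝒮]` is a rational extension of its bounded part, and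
`Q(X)` of `C(X)`, the abstract criterion `IsRationalExtension.nonempty_maxQuot_algEquiv` yields both
rings of quotients. If `|c d| ≤ M |d|` for all `d` in a dense ideal, then `|c| ≤ M`, again by a bump
function.

For the completion, `C[𝒢₀(βX)]` is complete because countable intersections of dense `G_δ`-sets are
dense `G_δ` and uniform limits are continuous. A continuous function on a dense subset of `βX`
extends to a `G_δ`-set, which embeds `Q(X)` isometrically; locally constant functions on dense open
sets show that the image is dense. -/

namespace FGL

open Topology Filter

/-! ### Maximal rings of quotients and rational extensions. -/

section Algebra

variable {A : Type*} [CommRing A]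

theorem MaxQuot.exists_agree_of_mk_eq {D E : DenseIdeals A} {φ : HomIdeal D} {ψ : HomIdeal E}
    (h : MaxQuot.mk D φ = MaxQuot.mk E ψ) :
    ∃ (F : DenseIdeals A) (hD : D ≤ F) (hE : E ≤ F),
      ∀ x : F.ideal, φ ⟨x.1, hD x.2⟩ = ψ ⟨x.1, hE x.2⟩ := by
  obtain ⟨F, hD, hE, h⟩ := Quotient.exact h
  exact ⟨F, hD, hE, fun x => LinearMap.congr_fun h x⟩

variable {B : Type*} [CommRing B] [Algebra A B]

/-- If `b ≠ 0`, some multiple `b a` is a nonzero element of `A`, and it still annihilates `D`. This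
is the uniqueness principle behind `IsValue.unique`. -/
theorem IsRationalExtension.eq_zero_of_mul (hAB : IsRationalExtension A B) {D : Ideal A}
    (hD : IsDenseIdeal D) {b : B} (h : ∀ d ∈ D, b * algebraMap A B d = 0) : b = 0 := by
  by_contra hb
  obtain ⟨a, ⟨c, hc⟩, hne⟩ := hAB.2 b b hb
  refine hne ?_
  rw [← hc, hD c fun d hd => hAB.1 ?_, map_zero]
  rw [map_mul, hc, mul_right_comm, h d hd, zero_mul, map_zero]

/-- The ideal of denominators of `b`. -/
def denominatorIdeal (A : Type*) [CommRing A] {B : Type*} [CommRing B] [Algebra A B] (b : B) :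
    Ideal A where
  carrier := {a | b * algebraMap A B a ∈ Set.range (algebraMap A B)}
  add_mem' := by
    rintro x y ⟨u, hu⟩ ⟨v, hv⟩
    exact ⟨u + v, by rw [map_add, map_add, mul_add, hu, hv]⟩
  zero_mem' := ⟨0, by simp⟩
  smul_mem' := by
    rintro c x ⟨u, hu⟩
    exact ⟨c * u, by rw [smul_eq_mul, map_mul, map_mul, hu]; ring⟩

theorem IsRationalExtension.exists_hom (hAB : IsRationalExtension A B) (b : B) :
    ∃ (D : DenseIdeals A) (φ : HomIdeal D), D.ideal = denominatorIdeal A b ∧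
      ∀ d : D.ideal, b * algebraMap A B d = algebraMap A B (φ d) := by
  have hdense : IsDenseIdeal (denominatorIdeal A b) := fun a ha => by
    by_contra hne
    obtain ⟨c, hc, hne'⟩ := hAB.2 b (algebraMap A B a)
      (fun h => hne (hAB.1 (h.trans (map_zero _).symm)))
    exact hne' (by rw [← map_mul, ha c hc, map_zero])
  choose f hf using fun d : denominatorIdeal A b => d.2
  refine ⟨⟨_, hdense⟩, ⟨⟨f, fun x y => hAB.1 ?_⟩, fun a x => hAB.1 ?_⟩, rfl, fun d => (hf d).symm⟩
  · rw [map_add, hf, hf, hf, ← mul_add, ← map_add]; rfl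
  · rw [RingHom.id_apply, smul_eq_mul, map_mul, hf, hf, mul_left_comm, ← map_mul]; rfl

/-- `b` is the element of the extension `B` corresponding to the quotient `q`. -/
def IsValue (q : MaxQuot A) (b : B) : Prop :=
  ∃ (D : DenseIdeals A) (φ : HomIdeal D), q = MaxQuot.mk D φ ∧
    ∀ d : D.ideal, b * algebraMap A B d = algebraMap A B (φ d)

theorem IsValue.unique (hAB : IsRationalExtension A B) {q : MaxQuot A} {b c : B}
    (hb : IsValue q b) (hc : IsValue q c) : b = c := by
  obtain ⟨D, φ, rfl, hb⟩ := hb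
  obtain ⟨E, ψ, h, hc⟩ := hc
  obtain ⟨F, hD, hE, hF⟩ := MaxQuot.exists_agree_of_mk_eq h
  refine sub_eq_zero.1 (hAB.eq_zero_of_mul F.dense fun d hd => ?_)
  rw [sub_mul, hb ⟨d, hD hd⟩, hc ⟨d, hE hd⟩, hF ⟨d, hd⟩, sub_self]

theorem IsValue.add {q r : MaxQuot A} {b c : B} (hb : IsValue q b) (hc : IsValue r c) :
    IsValue (q + r) (b + c) := by
  obtain ⟨D, φ, rfl, hb⟩ := hb
  obtain ⟨E, ψ, rfl, hc⟩ := hc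
  obtain ⟨F, hD, hE⟩ := exists_ge_ge D E
  refine ⟨F, HomIdeal.res D F hD φ + HomIdeal.res E F hE ψ, ?_, fun d => ?_⟩
  · rw [MaxQuot.mk_add, MaxQuot.mk_res, MaxQuot.mk_res]
  · rw [add_mul, LinearMap.add_apply, map_add]
    exact congrArg₂ (· + ·) (hb ⟨d, hD d.2⟩) (hc ⟨d, hE d.2⟩)

theorem IsValue.mul {q r : MaxQuot A} {b c : B} (hb : IsValue q b) (hc : IsValue r c) :
    IsValue (q * r) (b * c) := by
  obtain ⟨D, φ, rfl, hb⟩ := hb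
  obtain ⟨E, ψ, rfl, hc⟩ := hc
  refine ⟨MaxQuot.prodIdeal D E, MaxQuot.comp φ ψ, MaxQuot.mk_mul_mk .., fun d => ?_⟩
  rw [mul_assoc, hc ⟨d, Ideal.mul_le_right d.2⟩]
  exact hb ⟨ψ ⟨d, Ideal.mul_le_right d.2⟩, MaxQuot.map_mem_of_mem_mul ψ d.2⟩

theorem isValue_algebraMap (a : A) :
    IsValue (algebraMap A (MaxQuot A) a) (algebraMap A B a) :=
  ⟨_, MaxQuot.mulHom A a, rfl, fun d => (map_mul (algebraMap A B) a d.1).symm⟩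

/-- A rational extension of `A` containing all quotients of `A` is the maximal ring of quotients. -/
theorem IsRationalExtension.nonempty_maxQuot_algEquiv (hAB : IsRationalExtension A B)
    (h : ∀ (D : DenseIdeals A) (φ : HomIdeal D),
      ∃ b : B, ∀ d : D.ideal, b * algebraMap A B d = algebraMap A B (φ d)) :
    Nonempty (MaxQuot A ≃ₐ[A] B) := by
  have hex : ∀ q : MaxQuot A, ∃ b : B, IsValue q b := fun q => by
    induction q using MaxQuot.ind₁ with | _ D φ
    obtain ⟨b, hb⟩ := h D φ
    exact ⟨b, D, φ, rfl, hb⟩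
  choose f hf using hex
  let F : MaxQuot A →ₐ[A] B :=
    { toFun := f
      map_one' := IsValue.unique hAB (hf 1) (by simpa using isValue_algebraMap (B := B) (1 : A))
      map_zero' := IsValue.unique hAB (hf 0) (by simpa using isValue_algebraMap (B := B) (0 : A))
      map_mul' := fun x y => IsValue.unique hAB (hf _) ((hf x).mul (hf y))
      map_add' := fun x y => IsValue.unique hAB (hf _) ((hf x).add (hf y))
      commutes' := fun a => IsValue.unique hAB (hf _) (isValue_algebraMap a) }
  refine ⟨AlgEquiv.ofBijective F ⟨(injective_iff_map_eq_zero F).2 fun q hq => ?_, fun b => ?_⟩⟩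
  · obtain ⟨D, φ, rfl, hφ⟩ := hf q
    rw [← MaxQuot.mk_zero D]
    congr 1
    ext d
    refine hAB.1 ?_
    rw [← hφ, show f _ = 0 from hq, zero_mul, LinearMap.zero_apply, map_zero]
  · obtain ⟨D, φ, -, hφ⟩ := hAB.exists_hom b
    exact ⟨MaxQuot.mk D φ, IsValue.unique hAB (hf _) ⟨D, φ, rfl, hφ⟩⟩

/-- An element `b` of a rational extension acts on its denominator ideal as some `φ`. If `φ` is also
multiplication by `c`, then `c - b` kills a dense ideal. -/
theorem isRationallyComplete_of_exists_mul {A : Type u} [CommRing A]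
    (h : ∀ (D : DenseIdeals A) (φ : HomIdeal D), ∃ c : A, ∀ d : D.ideal, c * d = φ d) :
    IsRationallyComplete.{u, v} A := by
  intro B _ _ hAB b
  obtain ⟨D, φ, -, hφ⟩ := hAB.exists_hom b
  obtain ⟨c, hc⟩ := h D φ
  refine ⟨c, sub_eq_zero.1 (hAB.eq_zero_of_mul D.dense fun d hd => ?_)⟩
  rw [sub_mul, hφ ⟨d, hd⟩, ← hc, map_mul, sub_self]

end Algebra

/-! ### Disjoint open refinements. -/

section Refinement

variable {X : Type*} [TopologicalSpace X]

/-- Take a maximal disjoint family. If a nonempty open `V` missed its union, a nonempty `V ∩ O`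
could be added to the family. -/
theorem exists_disjoint_refinement (𝒪 : Set (Set X)) (hopen : ∀ O ∈ 𝒪, IsOpen O)
    (hdense : Dense (⋃₀ 𝒪)) :
    ∃ 𝒲 : Set (Set X), (∀ W ∈ 𝒲, IsOpen W ∧ ∃ O ∈ 𝒪, W ⊆ O) ∧ 𝒲.PairwiseDisjoint id ∧
      Dense (⋃₀ 𝒲) := by
  obtain ⟨𝒲, h𝒲⟩ := zorn_subset
    {𝒲 : Set (Set X) | (∀ W ∈ 𝒲, IsOpen W ∧ ∃ O ∈ 𝒪, W ⊆ O) ∧ 𝒲.PairwiseDisjoint id}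
    fun c hc hchain => ⟨⋃₀ c, ⟨fun W ⟨𝒱, h𝒱, hW⟩ => (hc h𝒱).1 W hW,
      (Set.pairwiseDisjoint_sUnion hchain.directedOn).2 fun 𝒱 h𝒱 => (hc h𝒱).2⟩,
      fun 𝒱 h𝒱 => Set.subset_sUnion_of_mem h𝒱⟩
  refine ⟨𝒲, h𝒲.prop.1, h𝒲.prop.2, dense_iff_inter_open.2 fun V hV hne => ?_⟩
  by_contra hempty
  obtain ⟨x, hxV, O, hO, hxO⟩ := hdense.inter_open_nonempty V hV hne
  have hdisj : ∀ W ∈ 𝒲, Disjoint (V ∩ O) W := fun W hW =>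
    Set.disjoint_left.2 fun y hy hyW => hempty ⟨y, hy.1, W, hW, hyW⟩
  have hmem : V ∩ O ∈ 𝒲 := h𝒲.le_of_ge
    (y := insert (V ∩ O) 𝒲) ⟨by
      rintro W (rfl | hW)
      · exact ⟨hV.inter (hopen O hO), O, hO, Set.inter_subset_right⟩
      · exact h𝒲.prop.1 W hW, h𝒲.prop.2.insert fun W hW _ => hdisj W hW⟩
    (Set.subset_insert _ _) (Set.mem_insert _ _)
  exact Set.disjoint_left.1 (hdisj _ hmem) ⟨hxV, hxO⟩ ⟨hxV, hxO⟩

end Refinement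

/-! ### Representatives as functions on the whole space. -/

namespace CLim

variable {X : Type*} [TopologicalSpace X] {𝒮 : DenseBase X}

/-- `a` is the class of the restriction to `S` of the function `F`. -/
def Represents (a : CLim 𝒮) (S : Set X) (F : X → ℝ) : Prop :=
  ∃ (hS : S ∈ 𝒮.sets) (hF : ContinuousOn F S),
    a = mk ⟨S, hS⟩ ⟨fun x => F x, continuousOn_iff_continuous_domRestrict.1 hF⟩

namespace Represents

variable {a b : CLim 𝒮} {S T : Set X} {F G : X → ℝ}

theorem mem (h : Represents a S F) : S ∈ 𝒮.sets := h.1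

theorem continuousOn (h : Represents a S F) : ContinuousOn F S := h.2.1

theorem mono (h : Represents a S F) (hT : T ∈ 𝒮.sets) (hTS : T ⊆ S) : Represents a T F := by
  obtain ⟨hS, hF, rfl⟩ := h
  exact ⟨hT, hF.mono hTS, (mk_res (S := ⟨S, hS⟩) (T := ⟨T, hT⟩) hTS _).symm⟩

theorem congr (h : Represents a S F) (hFG : Set.EqOn F G S) : Represents a S G := by
  obtain ⟨hS, hF, rfl⟩ := h
  refine ⟨hS, hF.congr hFG.symm, ?_⟩
  congr 1
  ext x
  exact hFG x.2

theorem eq (ha : Represents a S F) (hb : Represents b S F) : a = b :=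
  ha.2.2.trans hb.2.2.symm

theorem inter_left (ha : Represents a S F) (hT : T ∈ 𝒮.sets) : Represents a (S ∩ T) F :=
  ha.mono (𝒮.inter_mem _ ha.mem _ hT) Set.inter_subset_left

theorem inter_right (ha : Represents a T F) (hS : S ∈ 𝒮.sets) : Represents a (S ∩ T) F :=
  ha.mono (𝒮.inter_mem _ hS _ ha.mem) Set.inter_subset_right

theorem add (ha : Represents a S F) (hb : Represents b T G) :
    Represents (a + b) (S ∩ T) (F + G) := by
  obtain ⟨hS, hF, rfl⟩ := ha.inter_left hb.mem
  obtain ⟨-, hG, rfl⟩ := hb.inter_right ha.mem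
  exact ⟨hS, hF.add hG, (mk_add _ _ _).symm⟩

theorem sub (ha : Represents a S F) (hb : Represents b T G) :
    Represents (a - b) (S ∩ T) (F - G) := by
  obtain ⟨hS, hF, rfl⟩ := ha.inter_left hb.mem
  obtain ⟨-, hG, rfl⟩ := hb.inter_right ha.mem
  exact ⟨hS, hF.sub hG, (mk_sub _ _ _).symm⟩

theorem mul (ha : Represents a S F) (hb : Represents b T G) :
    Represents (a * b) (S ∩ T) (F * G) := by
  obtain ⟨hS, hF, rfl⟩ := ha.inter_left hb.mem
  obtain ⟨-, hG, rfl⟩ := hb.inter_right ha.mem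
  exact ⟨hS, hF.mul hG, (mk_mul _ _ _).symm⟩

theorem le_size (h : Represents a S F) {x : X} (hx : x ∈ S) :
    |F x| / (1 + |F x|) ≤ size a := by
  obtain ⟨hS, hF, rfl⟩ := h
  exact le_sizeFun (Y := S) ⟨fun x => F x, continuousOn_iff_continuous_domRestrict.1 hF⟩ ⟨x, hx⟩

theorem size_le (h : Represents a S F) {r : ℝ} (hr : 0 ≤ r)
    (hle : ∀ x ∈ S, |F x| / (1 + |F x|) ≤ r) : size a ≤ r := by
  obtain ⟨hS, hF, rfl⟩ := h
  exact Real.iSup_le (fun s => hle s.1 s.2) hr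

end Represents

theorem represents_mk (S : 𝒮.Index) (f : C(S.set, ℝ)) {F : X → ℝ} (hF : ∀ x : S.set, F x = f x) :
    Represents (mk S f) S.set F := by
  have hFf : S.set.domRestrict F = f := funext hF
  refine ⟨S.mem, continuousOn_iff_continuous_domRestrict.2 (hFf ▸ f.continuous), ?_⟩
  congr 1
  ext x
  exact (hF x).symm

theorem exists_represents_mk (S : 𝒮.Index) (f : C(S.set, ℝ)) :
    ∃ F : X → ℝ, (∀ x : S.set, F x = f x) ∧ Represents (mk S f) S.set F :=
  ⟨Function.extend Subtype.val f 0, Subtype.val_injective.extend_apply f 0,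
    represents_mk S f (Subtype.val_injective.extend_apply f 0)⟩

theorem exists_represents (a : CLim 𝒮) : ∃ S F, Represents a S F := by
  induction a using ind₁ with | _ S f
  obtain ⟨F, -, hF⟩ := exists_represents_mk S f
  exact ⟨_, F, hF⟩

theorem exists_represents_of_continuousOn {S : Set X} (hS : S ∈ 𝒮.sets) {F : X → ℝ}
    (hF : ContinuousOn F S) : ∃ a : CLim 𝒮, Represents a S F := ⟨_, hS, hF, rfl⟩

theorem represents_zero {S : Set X} (hS : S ∈ 𝒮.sets) : Represents (0 : CLim 𝒮) S 0 :=
  ⟨hS, continuousOn_const, (mk_zero _).symm⟩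

theorem represents_one {S : Set X} (hS : S ∈ 𝒮.sets) : Represents (1 : CLim 𝒮) S 1 :=
  ⟨hS, continuousOn_const, (mk_one _).symm⟩

theorem represents_ofC {S : Set X} (hS : S ∈ 𝒮.sets) (f : C(X, ℝ)) :
    Represents (ofC 𝒮 f) S f :=
  ⟨hS, f.continuous.continuousOn, ofC_eq ⟨S, hS⟩ f⟩

theorem size_nonneg (a : CLim 𝒮) : 0 ≤ size a := by
  induction a using ind₁ with | _ S f
  exact Real.iSup_nonneg fun _ => by positivity

theorem size_zero : size (0 : CLim 𝒮) = 0 := by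
  have h := dist_self (0 : CLim 𝒮)
  rwa [show dist (0 : CLim 𝒮) 0 = size ((0 : CLim 𝒮) - 0) from rfl, sub_zero] at h

theorem eq_of_size_sub {a b : CLim 𝒮} (h : size (a - b) = 0) : a = b := eq_of_dist_eq_zero h

/-- Equality in the direct limit only promises agreement on a smaller member. Agreement on all of `S
∩ T` holds because `size` is the same for every representative, so the difference has supremum zero.
-/
theorem Represents.eqOn {a : CLim 𝒮} {S T : Set X} {F G : X → ℝ} (h : Represents a S F)
    (h' : Represents a T G) : Set.EqOn F G (S ∩ T) := fun x hx => by
  have h1 := (h.sub h').le_size hx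
  rw [sub_self, size_zero] at h1
  by_contra hne
  have : 0 < |(F - G) x| := abs_pos.2 (sub_ne_zero.2 hne)
  exact absurd h1 (not_le.2 (by positivity))

theorem Represents.eq_of_eqOn {a b : CLim 𝒮} {S T : Set X} {F G : X → ℝ} (h : Represents a S F)
    (h' : Represents b T G) (hFG : Set.EqOn F G (S ∩ T)) : a = b :=
  ((h.inter_left h'.mem).congr hFG).eq (h'.inter_right h.mem)

theorem mem_bounded_iff {a : CLim 𝒮} :
    a ∈ bounded 𝒮 ↔ ∃ M S F, Represents a S F ∧ ∀ x ∈ S, |F x| ≤ M := by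
  constructor
  · rintro ⟨M, S, f, rfl, hM⟩
    obtain ⟨F, hF, hr⟩ := exists_represents_mk S f
    exact ⟨M, _, F, hr, fun x hx => (hF ⟨x, hx⟩).symm ▸ hM _⟩
  · rintro ⟨M, S, F, ⟨hS, hF, rfl⟩, hM⟩
    exact ⟨M, _, _, rfl, fun x => hM x x.2⟩

theorem absLE_iff {M : ℝ} {a b : CLim 𝒮} :
    AbsLE M a b ↔ ∃ S F G, Represents a S F ∧ Represents b S G ∧ ∀ x ∈ S, |F x| ≤ M * |G x| := by
  constructor
  · rintro ⟨S, f, g, rfl, rfl, h⟩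
    obtain ⟨F, hF, hr⟩ := exists_represents_mk S f
    obtain ⟨G, hG, hr'⟩ := exists_represents_mk S g
    exact ⟨_, F, G, hr, hr', fun x hx => (hF ⟨x, hx⟩).symm ▸ (hG ⟨x, hx⟩).symm ▸ h _⟩
  · rintro ⟨S, F, G, ⟨hS, hF, rfl⟩, ⟨-, hG, rfl⟩, h⟩
    exact ⟨_, _, _, rfl, rfl, fun x => h x x.2⟩

theorem ofC_injective : Function.Injective (ofC 𝒮) := fun f g h => by
  obtain ⟨S, hS⟩ := 𝒮.nonempty
  have h1 := (represents_ofC hS f).eqOn (h ▸ represents_ofC hS g)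
  rw [Set.inter_self] at h1
  exact DFunLike.coe_injective (f.continuous.ext_on (𝒮.dense S hS) g.continuous h1)

end CLim

/-! ### Bump functions and gluing over disjoint open sets. -/

theorem exists_bump {X : Type*} [TopologicalSpace X] [CompletelyRegularSpace X] {V : Set X}
    (hV : IsOpen V) {x : X} (hx : x ∈ V) :
    ∃ (f : C(X, ℝ)) (U : Set X), IsOpen U ∧ V ∪ U = Set.univ ∧ (∀ y ∈ U, f y = 0) ∧
      f x ≠ 0 := by
  obtain ⟨g, hg, hgx, hgV⟩ := CompletelyRegularSpace.completely_regular x Vᶜ hV.isClosed_compl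
    (fun h => h hx)
  -- Truncating at `1 / 2` makes the function vanish on an open neighbourhood of the complement of
  -- `V`, so that products with it can be extended by zero.
  refine ⟨⟨fun y => max (1 / 2 - (g y : ℝ)) 0, by fun_prop⟩, {y | 1 / 2 < (g y : ℝ)},
    isOpen_lt (by fun_prop) (by fun_prop), Set.eq_univ_of_forall fun y => ?_, fun y hy => ?_, ?_⟩
  · by_cases hy : y ∈ V
    · exact Or.inl hy
    · right
      have : g y = 1 := hgV hy
      simp only [Set.mem_ofPred_eq, this]
      norm_num
  · exact max_eq_right (sub_nonpos.2 (le_of_lt hy))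
  · simp [hgx]

/-- A base of dense sets is glueable if, together with a disjoint family of open sets `W` with dense
union and members `S W`, it contains the union of the sets `W ∩ S W`. -/
def DenseBase.Glueable {X : Type*} [TopologicalSpace X] (𝒮 : DenseBase X) : Prop :=
  ∀ (𝒲 : Set (Set X)) (S : Set X → Set X), (∀ W ∈ 𝒲, IsOpen W) → 𝒲.PairwiseDisjoint id →
    Dense (⋃₀ 𝒲) → (∀ W ∈ 𝒲, S W ∈ 𝒮.sets) → (⋃ W ∈ 𝒲, W ∩ S W) ∈ 𝒮.sets

theorem dense_biUnion_inter {X : Type*} [TopologicalSpace X] {𝒲 : Set (Set X)} {S : Set X → Set X}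
    (hopen : ∀ W ∈ 𝒲, IsOpen W) (hdense : Dense (⋃₀ 𝒲)) (hS : ∀ W ∈ 𝒲, Dense (S W)) :
    Dense (⋃ W ∈ 𝒲, W ∩ S W) := dense_iff_inter_open.2 fun V hV hne => by
  obtain ⟨x, hxV, W, hW, hxW⟩ := hdense.inter_open_nonempty V hV hne
  obtain ⟨y, hy, hyS⟩ := (hS W hW).inter_open_nonempty (V ∩ W) (hV.inter (hopen W hW)) ⟨x, hxV, hxW⟩
  exact ⟨y, hy.1, Set.mem_biUnion hW ⟨hy.2, hyS⟩⟩

theorem glueable_denseOpens (X : Type*) [TopologicalSpace X] : (denseOpens X).Glueable :=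
  fun _ _ hopen _ hdense hS =>
    ⟨isOpen_biUnion fun W hW => (hopen W hW).inter (hS W hW).1,
      dense_biUnion_inter hopen hdense fun W hW => (hS W hW).2⟩

/-- A point of the union lies in exactly one `W`, so the union over `W` commutes with the
intersection over `n`, and each stage is open. -/
theorem glueable_denseGδ (X : Type*) [TopologicalSpace X] [BaireSpace X] :
    (denseGδ X).Glueable := by
  intro 𝒲 S hopen hdisj hdense hS
  refine ⟨?_, dense_biUnion_inter hopen hdense fun W hW => (hS W hW).2⟩
  choose! O hO hSO using fun W hW => (hS W hW).1.eq_iInter_nat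
  have : (⋃ W ∈ 𝒲, W ∩ S W) = ⋂ n : ℕ, ⋃ W ∈ 𝒲, W ∩ O W n := by
    ext x
    simp only [Set.mem_iUnion, Set.mem_iInter, exists_prop]
    constructor
    · rintro ⟨W, hW, hxW, hxS⟩ n
      rw [hSO W hW] at hxS
      exact ⟨W, hW, hxW, Set.mem_iInter.1 hxS n⟩
    · intro h
      obtain ⟨W, hW, hxW, -⟩ := h 0
      refine ⟨W, hW, hxW, ?_⟩
      rw [hSO W hW]
      refine Set.mem_iInter.2 fun n => ?_
      obtain ⟨W', hW', hxW', hx⟩ := h n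
      obtain rfl : W = W' := hdisj.elim_set hW hW' x hxW hxW'
      exact hx
  rw [this]
  exact IsGδ.iInter_of_isOpen fun n => isOpen_biUnion fun W hW => (hopen W hW).inter (hO W hW n)

namespace CLim

variable {X : Type*} [TopologicalSpace X] {𝒮 : DenseBase X}

/-- No compatibility is needed: the pieces are disjoint, and near a point of `W` the glued domain is
just `W ∩ S W`. -/
theorem exists_glue (h𝒮 : 𝒮.Glueable) {𝒲 : Set (Set X)} {S : Set X → Set X} {F : Set X → X → ℝ}
    (hopen : ∀ W ∈ 𝒲, IsOpen W) (hdisj : 𝒲.PairwiseDisjoint id) (hdense : Dense (⋃₀ 𝒲))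
    (hS : ∀ W ∈ 𝒲, S W ∈ 𝒮.sets) (hF : ∀ W ∈ 𝒲, ContinuousOn (F W) (W ∩ S W)) :
    ∃ (c : CLim 𝒮) (G : X → ℝ), Represents c (⋃ W ∈ 𝒲, W ∩ S W) G ∧
      ∀ W ∈ 𝒲, Set.EqOn G (F W) W := by
  classical
  let G : X → ℝ := fun x => if h : ∃ W ∈ 𝒲, x ∈ W then F h.choose x else 0
  have hG : ∀ W ∈ 𝒲, Set.EqOn G (F W) W := fun W hW x hx => by
    have h : ∃ W ∈ 𝒲, x ∈ W := ⟨W, hW, hx⟩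
    have : h.choose = W := hdisj.elim_set h.choose_spec.1 hW x h.choose_spec.2 hx
    simp only [G, dif_pos h, this]
  have hGc : ContinuousOn G (⋃ W ∈ 𝒲, W ∩ S W) := fun x hx => by
    obtain ⟨W, hW, hxW, hxS⟩ := Set.mem_iUnion₂.1 hx
    have hWx : W ∈ 𝓝 x := (hopen W hW).mem_nhds hxW
    rw [← continuousWithinAt_inter hWx]
    refine (((hF W hW).congr ((hG W hW).mono Set.inter_subset_left)) x ⟨hxW, hxS⟩).mono ?_
    rintro y ⟨hy, hyW⟩
    obtain ⟨W', hW', hyW', hyS⟩ := Set.mem_iUnion₂.1 hy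
    obtain rfl : W = W' := hdisj.elim_set hW hW' y hyW hyW'
    exact ⟨hyW, hyS⟩
  obtain ⟨c, hc⟩ := exists_represents_of_continuousOn (h𝒮 𝒲 S hopen hdisj hdense hS) hGc
  exact ⟨c, G, hc, hG⟩

/-- A compatible family of fractions `p i / d i` whose denominators have no common annihilator in
`C(X)` has a common value in `C[𝒮]`. -/
theorem exists_mul_eq [CompletelyRegularSpace X] (h𝒮 : 𝒮.Glueable) {ι : Type*} (d p : ι → CLim 𝒮)
    (hcomp : ∀ i j, d i * p j = d j * p i)
    (hdense : ∀ f : C(X, ℝ), (∀ i, ofC 𝒮 f * d i = 0) → f = 0) :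
    ∃ c : CLim 𝒮, ∀ i, c * d i = p i := by
  have hrep : ∀ i, ∃ S F P, Represents (d i) S F ∧ Represents (p i) S P := fun i => by
    obtain ⟨S, F, hF⟩ := exists_represents (d i)
    obtain ⟨T, P, hP⟩ := exists_represents (p i)
    exact ⟨S ∩ T, F, P, hF.inter_left hP.mem, hP.inter_right hF.mem⟩
  choose S F P hF hP using hrep
  -- On `S i` the open set `O i` cuts out the points where `F i` is nonzero; off `S i` it is
  -- unconstrained.
  choose O hO hFO using fun i => continuousOn_iff'.1 (hF i).continuousOn {0}ᶜ isOpen_compl_singleton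
  have hne : ∀ i, ∀ x ∈ S i, x ∈ O i ↔ F i x ≠ 0 := fun i x hx => by
    simpa [hx, iff_comm] using Set.ext_iff.1 (hFO i) x
  have hOdense : Dense (⋃₀ Set.range O) := by
    -- If `V` misses every `O i`, a bump function in `V` annihilates all `d i`.
    refine dense_iff_inter_open.2 fun V hV ⟨x, hx⟩ => ?_
    by_contra hempty
    obtain ⟨f, U, -, hVU, hfU, hfx⟩ := exists_bump hV hx
    refine hfx (DFunLike.congr_fun (hdense f fun i => ?_) x)
    refine ((represents_ofC (hF i).mem f).mul (hF i)).eq_of_eqOn (represents_zero (hF i).mem) ?_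
    intro y hy
    rw [Set.inter_self, Set.inter_self] at hy
    rcases (hVU ▸ Set.mem_univ y : y ∈ V ∪ U) with hyV | hyU
    · have : y ∉ O i := fun hyO => hempty ⟨y, hyV, O i, ⟨i, rfl⟩, hyO⟩
      simp [not_not.1 (mt (hne i y hy).2 this)]
    · simp [hfU y hyU]
  obtain ⟨𝒲, h𝒲, hdisj, hWdense⟩ := exists_disjoint_refinement (Set.range O)
    (by rintro _ ⟨i, rfl⟩; exact hO i) hOdense
  have h𝒲' : ∀ W ∈ 𝒲, ∃ i, W ⊆ O i := fun W hW => by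
    obtain ⟨_, ⟨i, rfl⟩, h⟩ := (h𝒲 W hW).2
    exact ⟨i, h⟩
  rcases isEmpty_or_nonempty ι with hι | hι
  · exact ⟨0, isEmptyElim⟩
  choose! i hi using h𝒲'
  obtain ⟨c, G, hc, hG⟩ := exists_glue h𝒮 (S := fun W => S (i W))
    (F := fun W => P (i W) / F (i W)) (fun W hW => (h𝒲 W hW).1) hdisj hWdense
    (fun W _ => (hF (i W)).mem)
    (fun W hW => ((hP (i W)).continuousOn.mono Set.inter_subset_right).div
      ((hF (i W)).continuousOn.mono Set.inter_subset_right)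
      fun x hx => (hne _ x hx.2).1 (hi W hW hx.1))
  refine ⟨c, fun j => (hc.mul (hF j)).eq_of_eqOn (hP j) ?_⟩
  rintro x ⟨⟨hx, hxj⟩, -⟩
  obtain ⟨W, hW, hxW, hxS⟩ := Set.mem_iUnion₂.1 hx
  -- Compatibility is used after clearing the denominator `F (i W)`, so points where `F j` vanishes
  -- need no separate case.
  have h0 := (hF (i W)).mul (hP j)
  rw [← hcomp] at h0
  have h1 : F j x * P (i W) x = F (i W) x * P j x :=
    ((hF j).mul (hP (i W))).eqOn h0 ⟨⟨hxj, hxS⟩, hxS, hxj⟩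
  have h2 : F (i W) x ≠ 0 := (hne _ x hxS).1 (hi W hW hxW)
  rw [Pi.mul_apply, hG W hW hxW, Pi.div_apply, div_mul_eq_mul_div, div_eq_iff h2]
  linear_combination h1

end CLim

theorem HomIdeal.mul_apply_comm {A : Type*} [CommRing A] {D : DenseIdeals A} (φ : HomIdeal D)
    (d e : D.ideal) : (d : A) * φ e = e * φ d := by
  rw [← smul_eq_mul, ← smul_eq_mul, ← map_smul, ← map_smul]
  congr 1
  exact Subtype.ext (mul_comm _ _)

/-! ### Rational extensions of rings of functions and their bounded parts. -/

namespace CLim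

variable {X : Type*} [TopologicalSpace X]

theorem isRationalExtension_Q [CompletelyRegularSpace X] : IsRationalExtension C(X, ℝ) (Q X) := by
  refine ⟨ofC_injective, fun b b' hb' => ?_⟩
  obtain ⟨S, F, hF⟩ := exists_represents b
  obtain ⟨T, G, hG⟩ := exists_represents b'
  obtain ⟨x, hx, hGx⟩ : ∃ x ∈ S ∩ T, G x ≠ 0 := by
    by_contra! h
    exact hb' ((hG.inter_right hF.mem).eq_of_eqOn (represents_zero hF.mem)
      fun x hx => h x hx.1)
  obtain ⟨f, U, hU, hSU, hfU, hfx⟩ := exists_bump hF.mem.1 hx.1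
  classical
  -- The product of `b` with a bump function inside the open set `S` extends by zero: `S` and `U`
  -- form an open cover on which continuity is checked.
  let g : X → ℝ := fun y => if y ∈ S then F y * f y else 0
  have hgS : Set.EqOn g (F * f) S := fun y hy => if_pos hy
  have hgU : Set.EqOn g 0 U := fun y hy => by
    simp [g, hfU y hy]
  have hg : Continuous g := by
    rw [continuous_iff_continuousAt]
    intro y
    rcases (hSU ▸ Set.mem_univ y : y ∈ S ∪ U) with hy | hy
    · exact ((hF.continuousOn.mul f.continuous.continuousOn).congr hgS).continuousAt
        (hF.mem.1.mem_nhds hy)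
    · exact (continuousOn_const.congr hgU).continuousAt (hU.mem_nhds hy)
  refine ⟨f, ⟨⟨g, hg⟩, (represents_ofC hF.mem _).eq_of_eqOn
    (hF.mul (represents_ofC hF.mem f)) fun y hy => hgS hy.1⟩, fun h => ?_⟩
  have h0 := (hG.mul (represents_ofC hF.mem f))
  rw [show b' * ofC _ f = 0 from h] at h0
  have := h0.eqOn (represents_zero hF.mem) ⟨⟨hx.2, hx.1⟩, hx.1⟩
  exact mul_ne_zero hGx hfx this

theorem nonempty_maxQuot_algEquiv_Q [CompletelyRegularSpace X] :
    Nonempty (MaxQuot C(X, ℝ) ≃ₐ[C(X, ℝ)] Q X) := by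
  refine isRationalExtension_Q.nonempty_maxQuot_algEquiv fun D φ => ?_
  refine exists_mul_eq (glueable_denseOpens X) (fun d : D.ideal => ofC _ d)
    (fun d => ofC _ (φ d)) (fun d e => ?_) fun f hf => D.dense f fun d hd =>
      ofC_injective (𝒮 := denseOpens X) ?_
  · rw [← map_mul, ← map_mul, HomIdeal.mul_apply_comm]
  · rw [map_mul, map_zero, hf ⟨d, hd⟩]

variable {𝒮 : DenseBase X}

theorem isRationallyComplete [CompletelyRegularSpace X] (h𝒮 : 𝒮.Glueable) :
    IsRationallyComplete.{_, v} (CLim 𝒮) :=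
  isRationallyComplete_of_exists_mul fun D φ =>
    exists_mul_eq h𝒮 (fun d : D.ideal => (d : CLim 𝒮)) φ (HomIdeal.mul_apply_comm φ)
      fun f hf => ofC_injective
        ((D.dense (ofC 𝒮 f) fun d hd => hf ⟨d, hd⟩).trans (map_zero _).symm)

/-- The multiplier is `1 / (1 + b²)`: it is bounded, its product with `b` is bounded, and it is
invertible in `C[𝒮]`, so it kills no nonzero `b'`. -/
theorem isRationalExtension_bounded : IsRationalExtension (bounded 𝒮) (CLim 𝒮) := by
  refine ⟨Subtype.val_injective, fun b b' hb' => ?_⟩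
  obtain ⟨S, F, hF⟩ := exists_represents b
  have hpos : ∀ x, 0 < 1 + F x ^ 2 := fun x => by positivity
  obtain ⟨a, ha⟩ := exists_represents_of_continuousOn hF.mem
    (F := fun x => 1 / (1 + F x ^ 2))
    (continuousOn_const.div (continuousOn_const.add (hF.continuousOn.pow 2))
      fun x _ => (hpos x).ne')
  have haB : a ∈ bounded 𝒮 := mem_bounded_iff.2 ⟨1, S, _, ha, fun x _ => by
    rw [abs_of_pos (one_div_pos.2 (hpos x)), div_le_one (hpos x)]
    nlinarith [sq_nonneg (F x)]⟩
  have hbaB : b * a ∈ bounded 𝒮 := mem_bounded_iff.2 ⟨1, _, _, hF.mul ha, fun x _ => by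
    rw [Pi.mul_apply, mul_one_div, abs_div, abs_of_pos (hpos x), div_le_one (hpos x)]
    nlinarith [sq_abs (F x), sq_nonneg (|F x| - 1 / 2)]⟩
  refine ⟨⟨a, haB⟩, ⟨⟨b * a, hbaB⟩, rfl⟩, fun h => hb' ?_⟩
  have h : b' * a = 0 := h
  have hinv : a * (1 + b * b) = 1 :=
    (ha.mul ((represents_one hF.mem).add (hF.mul hF))).eq_of_eqOn (represents_one hF.mem)
      fun x _ => by
        simp only [Pi.mul_apply, Pi.add_apply, Pi.one_apply]
        rw [← sq, one_div_mul_cancel (hpos x).ne']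
  rw [← mul_one b', ← hinv, ← mul_assoc, h, zero_mul]

theorem ofC_mem_bounded [CompactSpace X] (f : C(X, ℝ)) : ofC 𝒮 f ∈ bounded 𝒮 := by
  obtain ⟨S, hS⟩ := 𝒮.nonempty
  exact mem_bounded_iff.2 ⟨‖f‖, S, f, represents_ofC hS f, fun x _ => f.norm_coe_le_norm x⟩

/-- Compactness puts `C(X)` inside the bounded part, so density of `D` can be tested with bump
functions. -/
theorem eq_zero_of_ofC_mul_eq_zero [CompactSpace X] {D : Ideal (bounded 𝒮)} (hD : IsDenseIdeal D)
    {f : C(X, ℝ)} (hf : ∀ d ∈ D, ofC 𝒮 f * d = 0) : f = 0 :=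
  ofC_injective (𝒮 := 𝒮) <| (congrArg Subtype.val
    (hD ⟨ofC 𝒮 f, ofC_mem_bounded f⟩ fun d hd => Subtype.ext (hf d hd))).trans (map_zero _).symm

theorem exists_mul_eq_of_hom_bounded [CompactSpace X] [CompletelyRegularSpace X]
    (h𝒮 : 𝒮.Glueable) (D : DenseIdeals (bounded 𝒮)) (φ : HomIdeal D) :
    ∃ c : CLim 𝒮, ∀ d : D.ideal, c * ((d : bounded 𝒮) : CLim 𝒮) = φ d :=
  exists_mul_eq h𝒮 (fun d : D.ideal => ((d : bounded 𝒮) : CLim 𝒮)) (fun d => (φ d : CLim 𝒮))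
    (fun d e => congrArg Subtype.val (HomIdeal.mul_apply_comm φ d e))
    fun _ hf => eq_zero_of_ofC_mul_eq_zero D.dense fun d hd => hf ⟨d, hd⟩

theorem nonempty_maxQuot_bounded_algEquiv [CompactSpace X] [CompletelyRegularSpace X]
    (h𝒮 : 𝒮.Glueable) : Nonempty (MaxQuot (bounded 𝒮) ≃ₐ[bounded 𝒮] CLim 𝒮) :=
  isRationalExtension_bounded.nonempty_maxQuot_algEquiv (exists_mul_eq_of_hom_bounded h𝒮)

/-- Where `|c| > M`, the inequality `|c d| ≤ M |d|` forces `d = 0`. A bump function on that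
relatively open set would annihilate `D`. -/
theorem mem_bounded_of_absLE [CompactSpace X] [CompletelyRegularSpace X]
    (D : DenseIdeals (bounded 𝒮)) {c : CLim 𝒮} {M : ℝ}
    (h : ∀ d ∈ D.ideal, AbsLE M (c * (d : CLim 𝒮)) d) : c ∈ bounded 𝒮 := by
  obtain ⟨S, F, hF⟩ := exists_represents c
  refine mem_bounded_iff.2 ⟨M, S, F, hF, fun x hx => ?_⟩
  by_contra hlt
  rw [not_le] at hlt
  obtain ⟨O, hO, hFO⟩ := continuousOn_iff'.1 (hF.continuousOn.abs) (Set.Ioi M) isOpen_Ioi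
  have hmem : ∀ y ∈ S, y ∈ O ↔ M < |F y| := fun y hy => by
    simpa [hy, iff_comm] using Set.ext_iff.1 hFO y
  obtain ⟨f, U, -, hOU, hfU, hfx⟩ := exists_bump hO ((hmem x hx).2 hlt)
  refine hfx (DFunLike.congr_fun (eq_zero_of_ofC_mul_eq_zero D.dense (f := f) fun d hd => ?_) x)
  obtain ⟨T, P, G, hP, hG, hle⟩ := absLE_iff.1 (h d hd)
  refine ((represents_ofC hF.mem f).mul hG).eq_of_eqOn (represents_zero hF.mem) ?_
  rintro y ⟨⟨hyS, hyT⟩, -⟩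
  rcases (hOU ▸ Set.mem_univ y : y ∈ O ∪ U) with hy | hy
  · have h1 : F y * G y = P y := (hF.mul hG).eqOn hP ⟨⟨hyS, hyT⟩, hyT⟩
    have h2 := hle y hyT
    rw [← h1, abs_mul] at h2
    have h3 : |G y| = 0 := by
      by_contra hne
      exact absurd (le_of_mul_le_mul_right h2 (lt_of_le_of_ne (abs_nonneg _) (Ne.symm hne)))
        (not_le.2 ((hmem y hyS).1 hy))
    simp [abs_eq_zero.1 h3]
  · simp [hfU y hy]

theorem isBoundedQuotient_iff [CompactSpace X] [CompletelyRegularSpace X] (h𝒮 : 𝒮.Glueable)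
    (q : MaxQuot (bounded 𝒮)) :
    IsBoundedQuotient q ↔ q ∈ Set.range (algebraMap (bounded 𝒮) (MaxQuot (bounded 𝒮))) := by
  constructor
  · rintro ⟨D, φ, M, rfl, hM⟩
    obtain ⟨c, hc⟩ := exists_mul_eq_of_hom_bounded h𝒮 D φ
    have hcB : c ∈ bounded 𝒮 := mem_bounded_of_absLE D fun d hd => by
      rw [hc ⟨d, hd⟩]
      exact hM ⟨d, hd⟩
    exact ⟨⟨c, hcB⟩, MaxQuot.mk_eq_of_agree (F := D) _ _ (le_top : D.ideal ≤ ⊤) le_rfl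
      fun d => Subtype.ext (hc d)⟩
  · rintro ⟨⟨a, ha⟩, rfl⟩
    obtain ⟨M, S, F, hF, hM⟩ := mem_bounded_iff.1 ha
    refine ⟨_, MaxQuot.mulHom _ ⟨a, ha⟩, M, rfl, fun ⟨d, _⟩ => absLE_iff.2 ?_⟩
    obtain ⟨T, G, hG⟩ := exists_represents (d : CLim 𝒮)
    refine ⟨_, _, G, hF.mul hG, hG.inter_right hF.mem, fun x hx => ?_⟩
    rw [Pi.mul_apply, abs_mul]
    exact mul_le_mul_of_nonneg_right (hM x hx.1) (abs_nonneg _)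

end CLim

/-! ### Completeness, and extension to a `G_δ`-set. -/

namespace CLim

theorem completeSpace_of_iInter_mem {X : Type*} [TopologicalSpace X] {𝒮 : DenseBase X}
    (hInter : ∀ S : ℕ → Set X, (∀ n, S n ∈ 𝒮.sets) → (⋂ n, S n) ∈ 𝒮.sets) :
    CompleteSpace (CLim 𝒮) := by
  refine Metric.complete_of_cauchySeq_tendsto fun u hu => ?_
  choose S F hF using fun n => exists_represents (u n)
  have hT := hInter S fun n => (hF n).mem
  set T := ⋂ n, S n
  replace hF : ∀ n, Represents (u n) T (F n) := fun n => (hF n).mono hT (Set.iInter_subset S n)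
  have hcauchy : UniformCauchySeqOn F atTop T := by
    refine Metric.uniformCauchySeqOn_iff.2 fun ε hε => ?_
    -- Since `t ↦ t / (1 + t)` is increasing, distance below `ε / (1 + ε)` means pointwise
    -- difference below `ε`.
    obtain ⟨N, hN⟩ := Metric.cauchySeq_iff.1 hu (ε / (1 + ε)) (by positivity)
    refine ⟨N, fun m hm n hn x hx => ?_⟩
    have h := (((hF m).sub (hF n)).le_size ⟨hx, hx⟩).trans_lt (hN m hm n hn)
    rw [div_lt_div_iff₀ (by positivity) (by positivity)] at h
    rw [Real.dist_eq]
    rw [Pi.sub_apply] at h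
    nlinarith
  have hlim : ∀ x ∈ T, ∃ l, Tendsto (fun n => F n x) atTop (𝓝 l) := fun x hx =>
    cauchySeq_tendsto_of_complete (hcauchy.cauchySeq hx)
  choose! L hL using hlim
  have hunif := hcauchy.tendstoUniformlyOn_of_tendsto hL
  obtain ⟨c, hc⟩ := exists_represents_of_continuousOn hT
    (hunif.continuousOn (Frequently.of_forall fun n => (hF n).continuousOn))
  refine ⟨c, Metric.tendsto_atTop'.2 fun ε hε => ?_⟩
  obtain ⟨N, hN⟩ := eventually_atTop.1 (Metric.tendstoUniformlyOn_iff.1 hunif (ε / 2) (half_pos hε))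
  refine ⟨N, fun n hn => lt_of_le_of_lt ?_ (half_lt_self hε)⟩
  refine ((hF n).sub hc).size_le (half_pos hε).le fun x hx => ?_
  refine (div_le_self (abs_nonneg _) (by linarith [abs_nonneg ((F n - L) x)])).trans ?_
  have := hN n hn.le x hx.1
  rw [dist_comm, Real.dist_eq] at this
  exact this.le

theorem completeSpace_denseGδ (X : Type*) [TopologicalSpace X] [BaireSpace X] :
    CompleteSpace (CLim (denseGδ X)) :=
  completeSpace_of_iInter_mem fun _ hS =>
    ⟨.iInter fun n => (hS n).1, dense_iInter_of_Gδ (fun n => (hS n).1) fun n => (hS n).2⟩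

end CLim

/-- A real-valued continuous function on a dense set extends continuously to a `G_δ`-set. -/
theorem exists_continuousOn_Gδ_extension {K : Type*} [TopologicalSpace K] {A : Set K}
    (hA : Dense A) {h : K → ℝ} (hh : ContinuousOn h A) :
    ∃ (G : Set K) (g : K → ℝ), IsGδ G ∧ A ⊆ G ∧ ContinuousOn g G ∧ Set.EqOn g h A := by
  -- `O ε` collects the points near which `h` oscillates by less than `ε` on `A`. On the
  -- intersection over `1 / (n + 1)`, `h` maps `𝓝[A] y` to a Cauchy filter.
  let O : ℝ → Set K := fun ε => ⋃₀ {U | IsOpen U ∧ ∀ u ∈ U ∩ A, ∀ v ∈ U ∩ A, dist (h u) (h v) < ε}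
  have hO : ∀ ε, IsOpen (O ε) := fun ε => isOpen_sUnion fun U hU => hU.1
  have hAO : ∀ ε > 0, A ⊆ O ε := fun ε hε x hx => by
    obtain ⟨U, hU, hxU, hUA⟩ := mem_nhdsWithin.1
      (hh x hx (Metric.ball_mem_nhds (h x) (half_pos hε)))
    refine ⟨U, ⟨hU, fun u hu v hv => ?_⟩, hxU⟩
    have h1 : dist (h u) (h x) < ε / 2 := hUA hu
    have h2 : dist (h v) (h x) < ε / 2 := hUA hv
    linarith [dist_triangle_right (h u) (h v) (h x)]
  have hlim : ∀ y ∈ ⋂ n : ℕ, O (1 / (n + 1)), ∃ c, Tendsto h (𝓝[A] y) (𝓝 c) := fun y hy => by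
    have : (𝓝[A] y).NeBot := mem_closure_iff_nhdsWithin_neBot.1 (hA y)
    refine CompleteSpace.complete (Metric.cauchy_iff.2 ⟨this.map h, fun ε hε => ?_⟩)
    obtain ⟨n, hn⟩ := exists_nat_one_div_lt hε
    obtain ⟨U, ⟨hU, hUA⟩, hyU⟩ := Set.mem_iInter.1 hy n
    refine ⟨h '' (A ∩ U), image_mem_map (inter_mem_nhdsWithin A (hU.mem_nhds hyU)), ?_⟩
    rintro _ ⟨u, hu, rfl⟩ _ ⟨v, hv, rfl⟩
    exact (hUA u hu.symm v hv.symm).trans hn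
  refine ⟨⋂ n : ℕ, O (1 / (n + 1)), extendFrom A h, .iInter_of_isOpen fun n => hO _,
    Set.subset_iInter fun n => hAO _ (by positivity),
    continuousOn_extendFrom (fun y _ => hA y) hlim, fun x hx => extendFrom_eq (hA x) (hh x hx)⟩

/-! ### Embedding `Q(X)` along a dense embedding. -/

namespace CLim

variable {X K : Type*} [TopologicalSpace X] [TopologicalSpace K] [BaireSpace K] {e : X → K}

/-- `b` is the continuous extension of `a` along `e`. -/
def IsExtension (e : X → K) (a : Q X) (b : CLim (denseGδ K)) : Prop :=
  ∃ V f G g, Represents a V f ∧ Represents b G g ∧ ∀ x ∈ V, e x ∈ G ∧ g (e x) = f x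

namespace IsExtension

variable {a a' : Q X} {b b' : CLim (denseGδ K)}

theorem add (h : IsExtension e a b) (h' : IsExtension e a' b') :
    IsExtension e (a + a') (b + b') := by
  obtain ⟨V, f, G, g, hf, hg, hfg⟩ := h
  obtain ⟨V', f', G', g', hf', hg', hfg'⟩ := h'
  exact ⟨_, _, _, _, hf.add hf', hg.add hg', fun x hx => ⟨⟨(hfg x hx.1).1, (hfg' x hx.2).1⟩,
    congrArg₂ (· + ·) (hfg x hx.1).2 (hfg' x hx.2).2⟩⟩

theorem sub (h : IsExtension e a b) (h' : IsExtension e a' b') :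
    IsExtension e (a - a') (b - b') := by
  obtain ⟨V, f, G, g, hf, hg, hfg⟩ := h
  obtain ⟨V', f', G', g', hf', hg', hfg'⟩ := h'
  exact ⟨_, _, _, _, hf.sub hf', hg.sub hg', fun x hx => ⟨⟨(hfg x hx.1).1, (hfg' x hx.2).1⟩,
    congrArg₂ (· - ·) (hfg x hx.1).2 (hfg' x hx.2).2⟩⟩

theorem mul (h : IsExtension e a b) (h' : IsExtension e a' b') :
    IsExtension e (a * a') (b * b') := by
  obtain ⟨V, f, G, g, hf, hg, hfg⟩ := h
  obtain ⟨V', f', G', g', hf', hg', hfg'⟩ := h'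
  exact ⟨_, _, _, _, hf.mul hf', hg.mul hg', fun x hx => ⟨⟨(hfg x hx.1).1, (hfg' x hx.2).1⟩,
    congrArg₂ (· * ·) (hfg x hx.1).2 (hfg' x hx.2).2⟩⟩

/-- The image of `V` is dense in `K`, so bounds for `g` on it pass to `G` by continuity. This yields
both uniqueness of extensions and the isometry. -/
theorem size_eq (he : IsDenseEmbedding e) (h : IsExtension e a b) : size a = size b := by
  obtain ⟨V, f, G, g, hf, hg, hfg⟩ := h
  refine le_antisymm (hf.size_le (size_nonneg b) fun x hx => ?_) ?_
  · rw [← (hfg x hx).2]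
    exact hg.le_size (hfg x hx).1
  · have hdense : Dense (e '' V) := he.dense.dense_image he.continuous (hf.mem.2)
    have hVG : e '' V ⊆ G := by
      rintro _ ⟨x, hx, rfl⟩
      exact (hfg x hx).1
    have hc : ContinuousOn (fun y => |g y| / (1 + |g y|)) G :=
      hg.continuousOn.abs.div (continuousOn_const.add hg.continuousOn.abs)
        fun y _ => by positivity
    refine hg.size_le (size_nonneg a) fun y hy => ?_
    have : (𝓝[e '' V] y).NeBot := mem_closure_iff_nhdsWithin_neBot.1 (hdense y)
    refine le_of_tendsto ((hc y hy).mono hVG) (eventually_mem_nhdsWithin.mono ?_)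
    rintro _ ⟨x, hx, rfl⟩
    rw [(hfg x hx).2]
    exact hf.le_size hx

theorem unique (he : IsDenseEmbedding e) (h : IsExtension e a b) (h' : IsExtension e a b') :
    b = b' :=
  eq_of_size_sub (by rw [← (h.sub h').size_eq he, sub_self, size_zero])

end IsExtension

theorem isExtension_ofC (he : Continuous e) (f : C(K, ℝ)) :
    IsExtension e (ofC _ (f.comp ⟨e, he⟩)) (ofC _ f) :=
  ⟨Set.univ, _, Set.univ, _, represents_ofC (𝒮 := denseOpens X) ⟨isOpen_univ, dense_univ⟩ _,
    represents_ofC (𝒮 := denseGδ K) ⟨.univ, dense_univ⟩ _, fun _ _ => ⟨trivial, rfl⟩⟩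

theorem exists_isExtension (he : IsDenseEmbedding e) (a : Q X) :
    ∃ b : CLim (denseGδ K), IsExtension e a b := by
  obtain ⟨V, f, hf⟩ := exists_represents a
  have hdense : Dense (e '' V) := he.dense.dense_image he.continuous (hf.mem.2)
  have hext : ∀ x, Function.extend e f 0 (e x) = f x := he.injective.extend_apply f 0
  have hh : ContinuousOn (Function.extend e f 0) (e '' V) := by
    rintro _ ⟨x, hx, rfl⟩
    rw [ContinuousWithinAt, ← he.isInducing.map_nhdsWithin_eq, tendsto_map'_iff, hext,
      Function.extend_comp he.injective]
    exact hf.continuousOn x hx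
  obtain ⟨G, g, hG, hVG, hg, hgh⟩ := exists_continuousOn_Gδ_extension hdense hh
  obtain ⟨b, hb⟩ := exists_represents_of_continuousOn (𝒮 := denseGδ K) ⟨hG, hdense.mono hVG⟩ hg
  exact ⟨b, V, f, G, g, hf, hb, fun x hx => ⟨hVG ⟨x, hx, rfl⟩,
    (hgh ⟨x, hx, rfl⟩).trans (hext x)⟩⟩

/-- On a disjoint family of open sets where `g` varies little, replace `g` by constants. The result
is continuous on a dense open set, hence pulls back to `Q(X)`. -/
theorem exists_isExtension_dist_lt (he : IsDenseEmbedding e) (b : CLim (denseGδ K)) {r : ℝ}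
    (hr : 0 < r) : ∃ (a : Q X) (b' : CLim (denseGδ K)), IsExtension e a b' ∧ dist b b' < r := by
  obtain ⟨G, g, hg⟩ := exists_represents b
  obtain ⟨𝒲, h𝒲, hdisj, hdense⟩ := exists_disjoint_refinement
    {U : Set K | IsOpen U ∧ ∃ c, ∀ u ∈ U ∩ G, |g u - c| ≤ r / 2} (fun U hU => hU.1) <|
    hg.mem.2.mono fun x hx => by
      obtain ⟨U, hU, hxU, hUG⟩ := mem_nhdsWithin.1
        (hg.continuousOn x hx (Metric.closedBall_mem_nhds (g x) (half_pos hr)))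
      exact ⟨U, ⟨hU, g x, fun u hu => hUG hu⟩, hxU⟩
  have hc : ∀ W ∈ 𝒲, ∃ c, ∀ u ∈ W ∩ G, |g u - c| ≤ r / 2 := fun W hW => by
    obtain ⟨O, ⟨-, c, hc⟩, hWO⟩ := (h𝒲 W hW).2
    exact ⟨c, fun u hu => hc u ⟨hWO hu.1, hu.2⟩⟩
  choose! c hc using hc
  obtain ⟨-, k, ⟨hT, hk, -⟩, hkc⟩ := exists_glue (glueable_denseOpens K) (S := fun _ => Set.univ)
    (F := fun W _ => c W) (fun W hW => (h𝒲 W hW).1) hdisj hdense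
    (fun _ _ => ⟨isOpen_univ, dense_univ⟩) fun _ _ => continuousOn_const
  set T := ⋃ W ∈ 𝒲, W ∩ Set.univ
  -- As `T` is open and `e` has dense range, `T` lies in the closure of `e '' (e ⁻¹' T)`.
  have hTe : Dense (e ⁻¹' T) := he.dense_image.1 <| dense_closure.1 <|
    hT.2.mono (he.dense.subset_closure_image_preimage_of_isOpen hT.1)
  obtain ⟨a, ha⟩ := exists_represents_of_continuousOn (𝒮 := denseOpens X)
    ⟨hT.1.preimage he.continuous, hTe⟩
    (hk.comp he.continuous.continuousOn (Set.mapsTo_preimage e T))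
  obtain ⟨b', hb'⟩ := exists_represents_of_continuousOn (𝒮 := denseGδ K) ⟨hT.1.isGδ, hT.2⟩ hk
  refine ⟨a, b', ⟨_, _, _, _, ha, hb', fun x hx => ⟨hx, rfl⟩⟩,
    lt_of_le_of_lt ?_ (half_lt_self hr)⟩
  refine (hg.sub hb').size_le (half_pos hr).le fun x hx => ?_
  refine (div_le_self (abs_nonneg _) (by linarith [abs_nonneg ((g - k) x)])).trans ?_
  obtain ⟨W, hW, hxW, -⟩ := Set.mem_iUnion₂.1 hx.2
  rw [Pi.sub_apply, hkc W hW hxW]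
  exact hc W hW x ⟨hxW, hx.1⟩

/-- `C[𝒢₀(K)]` is the completion of `Q(X)`, if `X` is densely embedded in `K`. -/
theorem exists_isometry_denseRange (he : IsDenseEmbedding e) :
    ∃ ι : Q X →+* CLim (denseGδ K), Isometry ι ∧ DenseRange ι ∧
      ∀ f : C(K, ℝ), ι (algebraMap C(X, ℝ) (Q X) (f.comp ⟨e, he.continuous⟩)) =
        algebraMap C(K, ℝ) (CLim (denseGδ K)) f := by
  choose j hj using exists_isExtension (K := K) he
  have hofC : ∀ f : C(K, ℝ), j (ofC _ (f.comp ⟨e, he.continuous⟩)) = ofC _ f := fun f =>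
    (hj _).unique he (isExtension_ofC he.continuous f)
  let ι : Q X →+* CLim (denseGδ K) :=
    { toFun := j
      map_one' := (hj 1).unique he (by
        simpa using isExtension_ofC he.continuous (1 : C(K, ℝ)))
      map_zero' := (hj 0).unique he (by
        simpa using isExtension_ofC he.continuous (0 : C(K, ℝ)))
      map_mul' := fun a b => (hj _).unique he ((hj a).mul (hj b))
      map_add' := fun a b => (hj _).unique he ((hj a).add (hj b)) }
  refine ⟨ι, Isometry.of_dist_eq fun a b => (((hj a).sub (hj b)).size_eq he).symm,
    Metric.denseRange_iff.2 fun b r hr => ?_, hofC⟩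
  obtain ⟨a, b', h, hlt⟩ := exists_isExtension_dist_lt he b hr
  exact ⟨a, by rwa [show ι a = b' from (hj a).unique he h]⟩

end CLim

end FGL

theorem mainTheorem4 (X : Type u) [TopologicalSpace X] [T35Space X] :
    -- `Q(X)` is the maximal ring of quotients of `C(X)`
    Nonempty (FGL.MaxQuot C(X, ℝ) ≃ₐ[C(X, ℝ)] FGL.Q X) ∧
    -- `QBar X` is the metric completion of `Q(X)`, by an embedding of rings over `C(βX) = C*(X)`
    (CompleteSpace (FGL.QBar X) ∧
      ∃ ι : FGL.Q X →+* FGL.QBar X, Isometry ι ∧ DenseRange ι ∧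
        ∀ f : C(StoneCech X, ℝ),
          ι (algebraMap C(X, ℝ) (FGL.Q X) (f.comp ⟨stoneCechUnit, continuous_stoneCechUnit⟩)) =
            algebraMap C(StoneCech X, ℝ) (FGL.QBar X) f) ∧
    -- the completion is rationally complete
    FGL.IsRationallyComplete.{u, v} (FGL.QBar X) ∧
    -- it is the maximal ring of quotients of its subring of bounded functions
    Nonempty (FGL.MaxQuot (FGL.QBarStar X) ≃ₐ[FGL.QBarStar X] FGL.QBar X) ∧
    -- the bounded part of that maximal ring of quotients is that subring
    (∀ q : FGL.MaxQuot (FGL.QBarStar X), FGL.IsBoundedQuotient q ↔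
      q ∈ Set.range (algebraMap (FGL.QBarStar X) (FGL.MaxQuot (FGL.QBarStar X)))) :=
  ⟨FGL.CLim.nonempty_maxQuot_algEquiv_Q, ⟨FGL.CLim.completeSpace_denseGδ _,
    FGL.CLim.exists_isometry_denseRange isDenseEmbedding_stoneCechUnit⟩,
    FGL.CLim.isRationallyComplete (FGL.glueable_denseGδ _),
    FGL.CLim.nonempty_maxQuot_bounded_algEquiv (FGL.glueable_denseGδ _),
    FGL.CLim.isBoundedQuotient_iff (FGL.glueable_denseGδ _)⟩
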